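/- Let $S$ be a pomonoid, that is, a monoid with a partial order such that $s\le t$ implies $us\le ut$ and $su\le tu$ for all $s,t,u\in S$. A left $S$-poset is a non-empty partially ordered set $A$ with a left action of $S$ such that $s\le t$ implies $sa\le ta$ and $a\le b$ implies $sa\le sb$ $(s,t\in S,\ a,b\in A)$; morphisms (the $S$-pomorphisms) are the order-preserving maps that commute with the action. A left $S$-poset $A$ is free if for some set $X$ and some map $\iota:X\to A$ every map from $X$ to a left $S$-poset $B$ factors through $\iota$ by exactly one morphism $A\to B$; it is projective if it is a projective object of the category of left $S$-posets. Let $\mathcal{F}r$ and $\mathcal{P}r$ be the classes of free and of projective left $S$-posets. A class $\mathcal{C}$ of left $S$-posets is axiomatisable if there is a set $\Pi$ of sentences of the first order language (with equality) with one unary function symbol for each $s\in S$ (interpreted as $a\mapsto sa$) and one binary relation symbol $\le$ such that a left $S$-poset belongs to $\mathcal{C}$ if and only if it satisfies all sentences of $\Pi$. For an ultrafilter $\Phi$ on a set $I$, the ultrapower $S^I/\Phi$ is the left $S$-poset of functions $I\to S$ modulo equality on a member of $\Phi$, with $[(a_i)]\le[(b_i)]$ if and only if $\{i: a_i\le b_i\}\in\Phi$,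 and $s[(a_i)]=[(sa_i)]$. For an idempotent $e\in S$ and $a\in S$, a factorisation $a=xy$ $(x,y\in S)$ is called an $e$-good factorisation of $a$ through $x$ if there are no $w,z\in S$ with $y=wz$, $e=xw$ and $Se=Sw$. Theorem. The following conditions are equivalent for a pomonoid $S$: (1) every ultrapower of $S$ (over every set, by every ultrafilter) is free as a left $S$-poset; (2) $\mathcal{P}r$ is axiomatisable and $S$ satisfies $(*)$: for every idempotent $e\in S$ with $e\neq 1$ there is a finite set $f\subseteq S$ such that every $a\in S$ has an $e$-good factorisation through $x$ for some $x\in f$; (3) $\mathcal{F}r$ is axiomatisable. -/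

import Mathlib

open FirstOrder CategoryTheory

universe u

/-- A left `S`-poset over a pomonoid `S`: a non-empty partially ordered set with an action of `S`
that is monotone in both arguments (`IsOrderedSMul`). -/
structure SPoset (S : Type u) [Monoid S] [PartialOrder S] : Type (u + 1) where
  carrier : Type u
  [order : PartialOrder carrier]
  [action : MulAction S carrier]
  [ordered : IsOrderedSMul S carrier]
  [nonempty : Nonempty carrier]

namespace SPoset

attribute [instance] order action ordered nonempty

variable {S : Type u} [Monoid S] [PartialOrder S]

instance : CoeSort (SPoset S) (Type u) := ⟨carrier⟩

/-- An `S`-pomorphism: an order-preserving map that commutes with the action of `S`. -/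
@[ext]
structure Hom (A B : SPoset S) where
  toFun : A → B
  monotone' : Monotone toFun
  map_smul' : ∀ (s : S) (a : A), toFun (s • a) = s • toFun a

/-- The category of left `S`-posets and `S`-pomorphisms. -/
instance : Category (SPoset S) where
  Hom A B := Hom A B
  id A := ⟨id, monotone_id, fun _ _ => rfl⟩
  comp f g := ⟨g.toFun ∘ f.toFun, g.monotone'.comp f.monotone', fun s a => by
    simp [f.map_smul', g.map_smul']⟩

/-- `A` is free on the set `X`, with insertion of generators `ι`, in the category of left
`S`-posets. -/
def IsFreeOn (A : SPoset S) (X : Type u) (ι : X → A) : Prop :=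
  ∀ (B : SPoset S) (f : X → B), ∃! g : A ⟶ B, ∀ x, Hom.toFun g (ι x) = f x

/-- Membership in the class of free left `S`-posets. -/
def IsFree (A : SPoset S) : Prop :=
  ∃ (X : Type u) (ι : X → A), IsFreeOn A X ι

/-- Membership in the class of projective left `S`-posets: the projective objects of the
category of left `S`-posets. -/
def IsProjective (A : SPoset S) : Prop :=
  Projective A

/-- Function symbols of the first order language of left `S`-posets: a unary symbol for each
element of `S`. -/
inductive LangFunctions (S : Type u) : ℕ → Type u
  | act (s : S) : LangFunctions S 1

/-- Relation symbols of the first order language of left `S`-posets: one binary symbol. -/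
inductive LangRelations : ℕ → Type
  | le : LangRelations 2

/-- The first order language of left `S`-posets. -/
def lang (S : Type u) : FirstOrder.Language.{u, 0} :=
  ⟨LangFunctions S, LangRelations⟩

/-- A left `S`-poset as a structure for the language of left `S`-posets. -/
instance langStructure (A : SPoset S) : (lang S).Structure A where
  funMap := fun f v => match f, v with
    | LangFunctions.act s, v => s • v 0
  RelMap := fun r v => match r, v with
    | LangRelations.le, v => v 0 ≤ v 1

/-- A class of left `S`-posets is axiomatisable if it consists of the left `S`-posets that satisfy
some set of first order sentences. -/
def Axiomatisable (C : SPoset S → Prop) : Prop :=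
  ∃ T : (lang S).Theory, ∀ A : SPoset S, C A ↔ A ⊨ T

/-- The ultrapower of the left `S`-poset `S` by an ultrafilter `φ` on `I`: classes of functions
`I → S` modulo `φ`-almost everywhere equality, ordered by `φ`-almost everywhere `≤`, with
`S` acting by left multiplication in each coordinate. -/
def ultrapower (S : Type u) [Monoid S] [PartialOrder S] [MulLeftMono S] [MulRightMono S]
    {I : Type u} (φ : Ultrafilter I) : SPoset S where
  carrier := Filter.Germ (φ : Filter I) S
  ordered :=
    { smul_le_smul_left := fun a b h c => by
        induction a using Filter.Germ.inductionOn with | h a => ?_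
        induction b using Filter.Germ.inductionOn with | h b => ?_
        exact Filter.Eventually.mono (Filter.Germ.coe_le.1 h) fun _ hi => mul_le_mul_right hi c
      smul_le_smul_right := fun c d h a => by
        induction a using Filter.Germ.inductionOn with | h a => ?_
        exact Filter.Eventually.of_forall fun i => mul_le_mul_left h (a i) }
  nonempty := ⟨((1 : S) : Filter.Germ (φ : Filter I) S)⟩

end SPoset

/-- Green's relation `ℒ` on a monoid: `a` and `b` generate the same principal left ideal. -/
def GreenL {S : Type u} [Monoid S] (a b : S) : Prop :=
  Set.range (fun s : S => s * a) = Set.range (fun s : S => s * b)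

/-- `a = x * y` is an `e`-good factorisation of `a` through `x`. -/
def IsGoodFactorisation {S : Type u} [Monoid S] (e a x y : S) : Prop :=
  a = x * y ∧ ∀ w z : S, e = x * w → GreenL e w → y ≠ w * z

/-- Condition `(*)`: for each idempotent `e ≠ 1` there is a finite set such that each element
of `S` has an `e`-good factorisation through some member of that set. -/
def ConditionStar (S : Type u) [Monoid S] : Prop :=
  ∀ e : S, IsIdempotentElem e → e ≠ 1 →
    ∃ f : Finset S, ∀ a : S, ∃ x ∈ f, ∃ y : S, IsGoodFactorisation e a x y

/-! ### Coordinates, projectivity and freeness -/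

namespace SPoset

section Coordinates

variable {S : Type u} [Monoid S] [PartialOrder S]

/-! Projectivity and freeness are made computable by `Coordinates`: `a = coeff a • gen a`, with
`coeff` a morphism to `S` and `gen` constant on components. These are the sections of the canonical
map from a free poset, so projective means having coordinates. Each `coeff (gen a)` is idempotent,
and free means that all of them can be made `1`.

Since `S` is free, Łoś's theorem makes its ultrapowers free under (3) and projective under (2). In
the latter case `(*)` forces every `coeff (gen a)` to be `1`: factor a representative of `gen a`
pointwise through a finite set, let the ultrafilter select one left factor, and the coefficient of
the remaining factor contradicts goodness (`unital_of_conditionStar`).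

Conversely, let all ultrapowers be free. Well-chosen ultrapowers show that one-sided inverses are
two-sided, that `x * w = y` has finitely many solutions `w`, and that `(*)` holds. Axiomatisability
then amounts to closure under ultraproducts and elementary substructures. Coordinatewise
coefficients on an ultraproduct lie in an ultrapower of `S`, whose own coordinates bring them back
to `S`. In an elementary substructure, `gen` stays inside because it solves an equation with
finitely many solutions. -/

theorem smul_mono_right (A : SPoset S) (s : S) {a b : A} (h : a ≤ b) : s • a ≤ s • b :=
  IsOrderedSMul.smul_le_smul_left a b h s

theorem smul_mono_left (A : SPoset S) {s t : S} (h : s ≤ t) (a : A) : s • a ≤ t • a :=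
  IsOrderedSMul.smul_le_smul_right s t h a

/-- Coordinates on a left `S`-poset: every element `a` is the multiple by `coeff a` of a chosen
element `gen a`, which depends only on the component of `a`, and `coeff` is a morphism to `S`. -/
structure Coordinates (A : SPoset S) where
  gen : A → A
  coeff : A → S
  gen_smul : ∀ (s : S) (a : A), gen (s • a) = gen a
  gen_eq_of_le : ∀ {a b : A}, a ≤ b → gen a = gen b
  coeff_smul : ∀ (s : S) (a : A), coeff (s • a) = s * coeff a
  coeff_mono : ∀ {a b : A}, a ≤ b → coeff a ≤ coeff b
  coeff_smul_gen : ∀ a : A, coeff a • gen a = a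

namespace Coordinates

variable {A : SPoset S} (c : A.Coordinates)

theorem gen_gen (a : A) : c.gen (c.gen a) = c.gen a := by
  conv_rhs => rw [← c.coeff_smul_gen a, c.gen_smul]

theorem coeff_mul_coeff_gen (a : A) : c.coeff a * c.coeff (c.gen a) = c.coeff a := by
  rw [← c.coeff_smul, c.coeff_smul_gen]

theorem isIdempotentElem_coeff_gen (a : A) : IsIdempotentElem (c.coeff (c.gen a)) := by
  have h := c.coeff_mul_coeff_gen (c.gen a)
  rwa [c.gen_gen] at h

/-- Coordinates are unital if the chosen generators have coefficient `1`. -/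
def Unital : Prop :=
  ∀ a, c.coeff (c.gen a) = 1

end Coordinates

/-- If equations `x * w = y` have finitely many solutions in `S`, then so do the corresponding
equations in a left `S`-poset with coordinates. -/
theorem Coordinates.finite_setOf_smul_eq (hS : ∀ x y : S, {w : S | x * w = y}.Finite)
    {A : SPoset S} (c : A.Coordinates) (s : S) (a : A) : {b : A | s • b = a}.Finite := by
  refine ((hS s (c.coeff a)).image fun w => w • c.gen a).subset ?_
  rintro b rfl
  exact ⟨c.coeff b, (c.coeff_smul s b).symm, by
    simp only [c.gen_smul, c.coeff_smul_gen]⟩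

/-- The underlying type of the free left `S`-poset on `X`. -/
@[ext]
structure FreeCarrier (S X : Type u) : Type u where
  gen : X
  coeff : S

instance (X : Type u) : PartialOrder (FreeCarrier S X) where
  le p q := p.gen = q.gen ∧ p.coeff ≤ q.coeff
  le_refl _ := ⟨rfl, le_rfl⟩
  le_trans _ _ _ h k := ⟨h.1.trans k.1, h.2.trans k.2⟩
  le_antisymm _ _ h k := FreeCarrier.ext h.1 (le_antisymm h.2 k.2)

instance (X : Type u) : MulAction S (FreeCarrier S X) where
  smul s p := ⟨p.gen, s * p.coeff⟩
  one_smul _ := FreeCarrier.ext rfl (one_mul _)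
  mul_smul _ _ _ := FreeCarrier.ext rfl (mul_assoc _ _ _)

/-- The free left `S`-poset on a non-empty set `X`. -/
def free [MulLeftMono S] [MulRightMono S] (X : Type u) [Nonempty X] : SPoset S where
  carrier := FreeCarrier S X
  ordered :=
    { smul_le_smul_left := fun _ _ h c => ⟨h.1, mul_le_mul_right h.2 c⟩
      smul_le_smul_right := fun _ _ h a => ⟨rfl, mul_le_mul_left h a.coeff⟩ }
  nonempty := ⟨⟨Classical.arbitrary X, 1⟩⟩

/-- The canonical morphism from the free left `S`-poset on the set `A` to `A`. -/
def freeCounit [MulLeftMono S] [MulRightMono S] (A : SPoset S) : free (S := S) A ⟶ A where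
  toFun p := p.coeff • p.gen
  monotone' p q h := (A.smul_mono_left h.2 p.gen).trans_eq (congrArg (q.coeff • ·) h.1)
  map_smul' s p := mul_smul s p.coeff p.gen

theorem comp_apply {A B C : SPoset S} (f : A ⟶ B) (g : B ⟶ C) (a : A) :
    Hom.toFun (f ≫ g) a = Hom.toFun g (Hom.toFun f a) :=
  rfl

theorem hom_ext {A B : SPoset S} {f g : A ⟶ B} (h : ∀ a, Hom.toFun f a = Hom.toFun g a) : f = g :=
  Hom.ext (funext h)

theorem epi_of_surjective {A B : SPoset S} (f : A ⟶ B) (hf : Function.Surjective (Hom.toFun f)) :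
    Epi f := by
  refine ⟨fun {C} g h hgh => hom_ext fun b => ?_⟩
  obtain ⟨a, rfl⟩ := hf b
  rw [← comp_apply, hgh, comp_apply]

/-- A section of the canonical morphism from a free left `S`-poset gives coordinates. -/
def Coordinates.ofSection [MulLeftMono S] [MulRightMono S] {A : SPoset S}
    (h : A ⟶ free (S := S) A) (hh : h ≫ freeCounit A = 𝟙 A) : A.Coordinates where
  gen a := (Hom.toFun h a : FreeCarrier S A).gen
  coeff a := (Hom.toFun h a : FreeCarrier S A).coeff
  gen_smul s a := by rw [h.map_smul']; rfl
  gen_eq_of_le hab := (h.monotone' hab).1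
  coeff_smul s a := by rw [h.map_smul']; rfl
  coeff_mono hab := (h.monotone' hab).2
  coeff_smul_gen a := congrArg (fun f : A ⟶ A => Hom.toFun f a) hh

/-- The underlying type of the cofree left `S`-poset on the two-element chain: the subsets of `S`
that are closed upwards. -/
def CofreeCarrier (S : Type u) [PartialOrder S] : Type u :=
  {F : Set S // IsUpperSet F}

instance : PartialOrder (CofreeCarrier S) :=
  inferInstanceAs (PartialOrder {F : Set S // IsUpperSet F})

instance [MulRightMono S] : MulAction S (CofreeCarrier S) where
  smul s F := ⟨{t | t * s ∈ F.1}, fun _ _ h ht => F.2 (mul_le_mul_left h s) ht⟩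
  one_smul F := Subtype.ext (Set.ext fun t => by
    change t * 1 ∈ F.1 ↔ _
    rw [mul_one])
  mul_smul s t F := Subtype.ext (Set.ext fun r => by
    change r * (s * t) ∈ F.1 ↔ r * s * t ∈ F.1
    rw [mul_assoc])

/-- The cofree left `S`-poset on the two-element chain. -/
def cofree (S : Type u) [Monoid S] [PartialOrder S] [MulLeftMono S] [MulRightMono S] :
    SPoset S where
  carrier := CofreeCarrier S
  ordered :=
    { smul_le_smul_left := fun _ _ h _ _ ht => h ht
      smul_le_smul_right := fun _ _ h F t ht => F.2 (mul_le_mul_right h t) ht }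
  nonempty := ⟨⟨Set.univ, isUpperSet_univ⟩⟩

/-- The morphism to the cofree left `S`-poset that classifies an upper set. -/
def classify [MulLeftMono S] [MulRightMono S] {A : SPoset S} (U : Set A) (hU : IsUpperSet U) :
    A ⟶ cofree S where
  toFun a := ⟨{s | s • a ∈ U}, fun _ _ h ht => hU (A.smul_mono_left h a) ht⟩
  monotone' _ _ h s hs := hU (A.smul_mono_right s h) hs
  map_smul' s a := Subtype.ext (Set.ext fun t => by
    change t • s • a ∈ U ↔ (t * s) • a ∈ U
    rw [mul_smul])

theorem eq_of_classify_eq [MulLeftMono S] [MulRightMono S] {A : SPoset S} {U V : Set A}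
    {hU : IsUpperSet U} {hV : IsUpperSet V} (h : classify U hU = classify V hV) : U = V := by
  ext a
  have h1 : {s : S | s • a ∈ U} = {s : S | s • a ∈ V} :=
    congrArg (fun f : A ⟶ cofree S => (Hom.toFun f a : CofreeCarrier S).1) h
  simpa using Set.ext_iff.1 h1 1

theorem classify_apply_eq [MulLeftMono S] [MulRightMono S] {A : SPoset S} {U V : Set A}
    {hU : IsUpperSet U} {hV : IsUpperSet V} {a : A} (h : ∀ s : S, s • a ∈ U ↔ s • a ∈ V) :
    Hom.toFun (classify U hU) a = Hom.toFun (classify V hV) a :=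
  Subtype.ext (Set.ext h)

/-- If `b` is missed, the upper sets `Ici b` and `Ioi b` differ only at `b`, so their classifying
maps agree on the image of `f`, which is closed under the action. -/
theorem surjective_of_epi [MulLeftMono S] [MulRightMono S] {A B : SPoset S} (f : A ⟶ B) [Epi f] :
    Function.Surjective (Hom.toFun f) := by
  intro b
  by_contra! hb
  have h : classify (Set.Ici b) (isUpperSet_Ici b) = classify (Set.Ioi b) (isUpperSet_Ioi b) := by
    refine (cancel_epi f).1 (hom_ext fun a => ?_)
    rw [comp_apply, comp_apply]
    refine classify_apply_eq fun s => ?_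
    rw [← f.map_smul']
    exact ⟨fun h => lt_of_le_of_ne h (hb _).symm, le_of_lt⟩
  have hb' : b ∈ Set.Ioi b := eq_of_classify_eq h ▸ Set.self_mem_Ici
  exact lt_irrefl b hb'

/-- A left `S`-poset with coordinates is projective. -/
theorem Coordinates.isProjective [MulLeftMono S] [MulRightMono S] {A : SPoset S}
    (c : A.Coordinates) : IsProjective A where
  factors {E X} f e _ := by
    choose l hl using surjective_of_epi e
    refine ⟨⟨fun a => c.coeff a • l (Hom.toFun f (c.gen a)), fun a b hab => ?_, fun s a => ?_⟩,
      hom_ext fun a => ?_⟩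
    · simp only [c.gen_eq_of_le hab]
      exact E.smul_mono_left (c.coeff_mono hab) _
    · simp only [c.gen_smul, c.coeff_smul, mul_smul]
    · change Hom.toFun e (c.coeff a • l (Hom.toFun f (c.gen a))) = _
      rw [e.map_smul', hl, ← f.map_smul', c.coeff_smul_gen]

theorem isProjective_iff [MulLeftMono S] [MulRightMono S] {A : SPoset S} :
    IsProjective A ↔ Nonempty A.Coordinates := by
  refine ⟨fun hA => ?_, fun ⟨c⟩ => c.isProjective⟩
  have : Projective A := hA
  have : Epi (freeCounit A) := epi_of_surjective _ fun a => ⟨⟨a, 1⟩, one_smul S a⟩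
  exact ⟨.ofSection (Projective.factorThru (𝟙 A) (freeCounit A)) (Projective.factorThru_comp _ _)⟩

theorem IsFree.exists_unital [MulLeftMono S] [MulRightMono S] {A : SPoset S} (hA : IsFree A) :
    ∃ c : A.Coordinates, c.Unital := by
  obtain ⟨X, ι, hι⟩ := hA
  obtain ⟨h, hh, -⟩ := hι (free A) fun x => ⟨ι x, 1⟩
  have hid : h ≫ freeCounit A = 𝟙 A :=
    (hι A ι).unique (fun x => by rw [comp_apply, hh]; exact one_smul S (ι x)) fun x => rfl
  let c := Coordinates.ofSection h hid
  have hgen (x : X) : c.gen (ι x) = ι x := congrArg FreeCarrier.gen (hh x)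
  have hcoeff (x : X) : c.coeff (ι x) = 1 := congrArg FreeCarrier.coeff (hh x)
  -- `U` contains every multiple of a generator, so it and the whole of `A` have classifying maps
  -- that agree on generators; uniqueness in the universal property gives `U = A`.
  let U : Set A := {a | c.coeff (c.gen a) = 1}
  have hU : IsUpperSet U := fun a b hab ha => by
    change c.coeff (c.gen b) = 1
    rwa [← c.gen_eq_of_le hab]
  have hUV : classify U hU = classify Set.univ isUpperSet_univ :=
    (hι (cofree S) fun x => Hom.toFun (classify U hU) (ι x)).unique (fun x => rfl) fun x =>
      classify_apply_eq fun s => iff_of_true (Set.mem_univ _) (by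
        change c.coeff (c.gen (s • ι x)) = 1
        rw [c.gen_smul, hgen, hcoeff])
  exact ⟨c, fun a => show a ∈ U from eq_of_classify_eq hUV ▸ Set.mem_univ a⟩

theorem Coordinates.Unital.isFree {A : SPoset S} {c : A.Coordinates} (hc : c.Unital) :
    IsFree A := by
  refine ⟨Set.range c.gen, Subtype.val, fun B f => ?_⟩
  refine ⟨⟨fun a => c.coeff a • f ⟨c.gen a, a, rfl⟩, fun a b hab => ?_, fun s a => ?_⟩, ?_, ?_⟩
  · simp only [c.gen_eq_of_le hab]
    exact B.smul_mono_left (c.coeff_mono hab) _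
  · simp only [c.gen_smul, c.coeff_smul, mul_smul]
  · rintro ⟨_, a, rfl⟩
    simp only [c.gen_gen, hc a, one_smul]
  · intro h hh
    refine hom_ext fun a => ?_
    change Hom.toFun h a = c.coeff a • f ⟨c.gen a, a, rfl⟩
    rw [← hh ⟨c.gen a, a, rfl⟩, ← h.map_smul', c.coeff_smul_gen]

theorem isFree_iff [MulLeftMono S] [MulRightMono S] {A : SPoset S} :
    IsFree A ↔ ∃ c : A.Coordinates, c.Unital :=
  ⟨IsFree.exists_unital, fun ⟨_, hc⟩ => hc.isFree⟩

end Coordinates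

end SPoset

/-! ### Ultrapowers of `S`, finiteness of solution sets and condition `(*)` -/

namespace SPoset

section Ultrapower

variable {S : Type u} [Monoid S] [PartialOrder S] [MulLeftMono S] [MulRightMono S]

/-- The class of a function in the ultrapower. -/
def ultrapowerMk {I : Type u} (φ : Ultrafilter I) (f : I → S) : ultrapower S φ :=
  (f : Filter.Germ (φ : Filter I) S)

section

variable {I : Type u} {φ : Ultrafilter I}

theorem ultrapowerMk_eq {f g : I → S} :
    ultrapowerMk φ f = ultrapowerMk φ g ↔ ∀ᶠ i in (φ : Filter I), f i = g i :=
  Filter.Germ.coe_eq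

theorem smul_ultrapowerMk (s : S) (f : I → S) :
    s • ultrapowerMk φ f = ultrapowerMk φ fun i => s * f i :=
  rfl

theorem exists_ultrapowerMk_eq (a : ultrapower S φ) : ∃ f : I → S, ultrapowerMk φ f = a :=
  Quotient.exists_rep a

end

/-- If ultrapowers of `S` have coordinates then right invertible elements of `S` are units. -/
theorem mul_eq_one_comm_of_coordinates
    (h : ∀ (I : Type u) (φ : Ultrafilter I), Nonempty (ultrapower S φ).Coordinates)
    {u v : S} (huv : u * v = 1) : v * u = 1 := by
  have huvn (n : ℕ) : u ^ n * v ^ n = 1 := by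
    induction n with
    | zero => simp
    | succ n ih => rw [pow_succ, pow_succ', mul_assoc, ← mul_assoc u v, huv, one_mul, ih]
  let φ : Ultrafilter (ULift.{u} ℕ) := Filter.hyperfilter _
  obtain ⟨c⟩ := h _ φ
  -- All `a m` share the generator of `a 0`. Truncated subtraction only affects the finitely many
  -- indices `n < m`.
  let a (m : ℕ) : ultrapower S φ := ultrapowerMk φ fun n => v ^ (n.down - m)
  have ha (m : ℕ) : v ^ m • a m = a 0 := by
    rw [smul_ultrapowerMk, ultrapowerMk_eq]
    have hfin : {n : ULift.{u} ℕ | n.down < m}.Finite :=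
      (Set.finite_lt_nat m).preimage ULift.down_injective.injOn
    filter_upwards [hfin.compl_mem_hyperfilter] with n hn
    have hn' : m ≤ n.down := not_lt.1 hn
    rw [← pow_add, Nat.add_sub_cancel' hn', Nat.sub_zero]
  obtain ⟨b, hb⟩ := exists_ultrapowerMk_eq (c.gen (a 0))
  have hab := c.coeff_smul_gen (a 0)
  rw [← hb, smul_ultrapowerMk, ultrapowerMk_eq] at hab
  obtain ⟨n, hn⟩ := hab.exists
  -- Coefficients do not depend on the index, so `n` may be fixed first and `m = n + 1` taken
  -- afterwards; cancelling `v ^ n` gives `v` a right inverse.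
  have h1 : v ^ n.down = v ^ (n.down + 1) * (c.coeff (a (n.down + 1)) * b n) := by
    rw [← mul_assoc, ← c.coeff_smul, ha, hn, Nat.sub_zero]
  have h2 : 1 = v * (c.coeff (a (n.down + 1)) * b n) := by
    rw [← huvn n.down, h1, pow_succ, mul_assoc, ← mul_assoc (u ^ n.down), huvn, one_mul]
  have h3 : u = c.coeff (a (n.down + 1)) * b n := by
    rw [← mul_one u, h2, ← mul_assoc, huv, one_mul]
  rw [h3, ← h2]

/-- If ultrapowers of `S` have unital coordinates then equations `x * w = y` have finitely many
solutions `w`. -/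
theorem finite_setOf_mul_eq
    (h : ∀ (I : Type u) (φ : Ultrafilter I), ∃ c : (ultrapower S φ).Coordinates, c.Unital)
    (x y : S) : {w : S | x * w = y}.Finite := by
  by_contra hinf
  have : Infinite {w : S | x * w = y} := Set.infinite_coe_iff.2 hinf
  let φ := Filter.hyperfilter {w : S | x * w = y}
  obtain ⟨c, hc⟩ := h _ φ
  let k (s : S) : ultrapower S φ := ultrapowerMk φ fun _ => s
  let w : ultrapower S φ := ultrapowerMk φ Subtype.val
  have hxw : x • w = y • k 1 := by
    rw [smul_ultrapowerMk, smul_ultrapowerMk, ultrapowerMk_eq]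
    exact Filter.Eventually.of_forall fun w => by rw [w.2, mul_one]
  have hgen : c.gen w = c.gen (k 1) := by rw [← c.gen_smul x, hxw, c.gen_smul]
  obtain ⟨d, hd⟩ := exists_ultrapowerMk_eq (c.gen (k 1))
  have h1 := c.coeff_smul_gen (k 1)
  have h2 := c.coeff_smul_gen w
  rw [hgen, ← hd, smul_ultrapowerMk, ultrapowerMk_eq] at h2
  rw [← hd, smul_ultrapowerMk, ultrapowerMk_eq] at h1
  obtain ⟨i, hi⟩ := h1.exists
  have hcomm : d i * c.coeff (k 1) = 1 :=
    mul_eq_one_comm_of_coordinates (fun I φ => ⟨(h I φ).choose⟩) hi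
  -- As `d i` is a two-sided inverse of `coeff (k 1)`, the representative `d` is almost everywhere
  -- equal to `d i`. So the inclusion is almost everywhere constant, which a hyperfilter forbids.
  have hconst : ∀ᶠ v in (φ : Filter {w : S | x * w = y}), v.1 = c.coeff w * d i := by
    filter_upwards [h1, h2] with v hv1 hv2
    rw [← hv2, ← one_mul (d v), ← hcomm, mul_assoc, hv1, mul_one]
  exact Filter.notMem_hyperfilter_of_finite
    (Set.Subsingleton.finite fun v hv v' hv' => Subtype.ext (hv.trans hv'.symm)) hconst

/-- If ultrapowers of `S` have unital coordinates then `S` satisfies condition `(*)`. -/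
theorem conditionStar_of_unital
    (h : ∀ (I : Type u) (φ : Ultrafilter I), ∃ c : (ultrapower S φ).Coordinates, c.Unital) :
    ConditionStar S := by
  intro e he he1
  by_contra! hbad
  choose a ha using hbad
  let φ : Ultrafilter (Finset S) := Ultrafilter.of Filter.atTop
  obtain ⟨c, hc⟩ := h _ φ
  let A : ultrapower S φ := ultrapowerMk φ a
  obtain ⟨b, hb⟩ := exists_ultrapowerMk_eq (c.gen A)
  have hA := c.coeff_smul_gen A
  rw [← hb, smul_ultrapowerMk, ultrapowerMk_eq] at hA
  -- The ultrafilter refines `atTop`, so the fixed element `coeff A` eventually belongs to the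
  -- finite set through which `a f` has no good factorisation.
  have hmem : ∀ᶠ f in (φ : Filter (Finset S)), c.coeff A ∈ f :=
    Ultrafilter.of_le Filter.atTop
      ((Filter.eventually_ge_atTop {c.coeff A}).mono fun f hf => hf (Finset.mem_singleton_self _))
  have hex : ∀ᶠ f in (φ : Filter (Finset S)),
      ∃ w ∈ {w : S | c.coeff A * w = e}, GreenL e w ∧ ∃ z, b f = w * z := by
    filter_upwards [hA, hmem] with f hf hxf
    have := ha f _ hxf (b f)
    simp only [IsGoodFactorisation, not_and, not_forall, not_not] at this
    obtain ⟨w, z, hw, hew, hz⟩ := this hf.symm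
    exact ⟨w, hw.symm, hew, z, hz⟩
  obtain ⟨w, -, hw⟩ :=
    (Ultrafilter.eventually_exists_mem_iff (finite_setOf_mul_eq h _ _)).1 hex
  obtain ⟨_, hew, -⟩ := hw.exists
  have hz : ∀ f, ∃ z, GreenL e w ∧ (∃ z, b f = w * z) → b f = w * z := fun f => by
    by_cases hf : ∃ z, b f = w * z
    · exact ⟨_, fun _ => hf.choose_spec⟩
    · exact ⟨1, fun h => absurd h.2 hf⟩
  choose z hz using hz
  have hgen : c.gen A = w • ultrapowerMk φ z := by
    rw [← hb, smul_ultrapowerMk, ultrapowerMk_eq]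
    exact hw.mono hz
  -- Thus `w` is a unit lying in `Se`, so `1 ∈ Se` and `e = 1`.
  have h1 : w * c.coeff (ultrapowerMk φ z) = 1 := by rw [← c.coeff_smul, ← hgen, hc]
  have h2 := mul_eq_one_comm_of_coordinates (fun I φ => ⟨(h I φ).choose⟩) h1
  obtain ⟨s, hs⟩ : w ∈ Set.range fun s : S => s * e := hew ▸ ⟨1, one_mul w⟩
  have h3 : c.coeff (ultrapowerMk φ z) * s * e = 1 := by rw [← h2, ← hs, mul_assoc]
  exact he1 (by rw [← one_mul e, ← h3, mul_assoc, he.eq])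

/-- Under condition `(*)`, all coordinates on an ultrapower of `S` are unital. -/
theorem unital_of_conditionStar (hS : ConditionStar S) {I : Type u} {φ : Ultrafilter I}
    (c : (ultrapower S φ).Coordinates) : c.Unital := by
  intro a
  by_contra he
  obtain ⟨f, hf⟩ := hS (c.coeff (c.gen a))
    (c.isIdempotentElem_coeff_gen a) he
  obtain ⟨b, hb⟩ := exists_ultrapowerMk_eq (c.gen a)
  choose p hp y hy using fun i => hf (b i)
  obtain ⟨x, -, hx⟩ := (Ultrafilter.eventually_exists_mem_iff (f := φ)
    (P := fun x i => p i = x) f.finite_toSet).1 (.of_forall fun i => ⟨p i, hp i, rfl⟩)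
  let Y : ultrapower S φ := ultrapowerMk φ y
  have hxY : x • Y = c.gen a := by
    rw [← hb, smul_ultrapowerMk, ultrapowerMk_eq]
    filter_upwards [hx] with i hi
    rw [(hy i).1, hi]
  have hgen : c.gen Y = c.gen a := by rw [← c.gen_smul x, hxY, c.gen_gen]
  have he' : c.coeff (c.gen a) = x * c.coeff Y := by rw [← c.coeff_smul, hxY]
  -- With `e = coeff (gen a)`: `e = x * coeff Y`, and `coeff Y * e = coeff Y` because `Y` and `a`
  -- share a generator.
  have hL : GreenL (c.coeff (c.gen a)) (c.coeff Y) := by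
    refine Set.Subset.antisymm ?_ ?_
    · rintro _ ⟨s, rfl⟩
      exact ⟨s * x, by simp only [he', mul_assoc]⟩
    · rintro _ ⟨s, rfl⟩
      exact ⟨s * c.coeff Y, by
        simp only [mul_assoc, ← hgen, c.coeff_mul_coeff_gen]⟩
  have hY := c.coeff_smul_gen Y
  rw [hgen, ← hb, smul_ultrapowerMk, ultrapowerMk_eq] at hY
  obtain ⟨i, hi, hix⟩ := (hY.and hx).exists
  exact (hy i).2 (c.coeff Y) (b i) (by rw [hix, he']) hL hi.symm

end Ultrapower
end SPoset

/-! ### Ultraproducts, Łoś's theorem and elementary embeddings -/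

namespace SPoset

section Ultraproduct

variable {S : Type u} [Monoid S] [PartialOrder S]

section

variable {I : Type u} (φ : Ultrafilter I) (M : I → SPoset S)

instance : PartialOrder ((φ : Filter I).Product fun i => M i) where
  le := Quotient.lift₂ (fun f g => ∀ᶠ i in (φ : Filter I), f i ≤ g i) fun f g f' g' h k =>
    propext (Filter.eventually_congr (by
      filter_upwards [h, k] with i hi ki
      rw [hi, ki]))
  le_refl := Quotient.ind fun f => .of_forall fun i => le_rfl
  le_trans := fun a b c => Quotient.inductionOn₃ a b c fun f g h hfg hgh => by
    filter_upwards [hfg, hgh] with i hi hi' using hi.trans hi'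
  le_antisymm := fun a b => Quotient.inductionOn₂ a b fun f g hfg hgf => Quotient.sound (by
    filter_upwards [hfg, hgf] with i hi hi' using hi.antisymm hi')

instance : MulAction S ((φ : Filter I).Product fun i => M i) where
  smul s := Quotient.map (fun f i => s • f i) fun f g h => by
    filter_upwards [h] with i hi
    rw [hi]
  one_smul := Quotient.ind fun f => congrArg _ (funext fun i => one_smul S (f i))
  mul_smul s t := Quotient.ind fun f => congrArg _ (funext fun i => mul_smul s t (f i))

/-- The ultraproduct of a family of left `S`-posets. -/
def ultraproduct : SPoset S where
  carrier := (φ : Filter I).Product fun i => M i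
  ordered :=
    { smul_le_smul_left := fun a b => Quotient.inductionOn₂ a b fun f g h c => by
        refine Filter.Eventually.mono h fun i hi => ?_
        exact (M i).smul_mono_right c hi
      smul_le_smul_right := fun c d h => Quotient.ind fun f =>
        .of_forall fun i => (M i).smul_mono_left h (f i) }
  nonempty := ⟨Quotient.mk _ fun i => Classical.arbitrary (M i)⟩

/-- The class of a choice function in an ultraproduct. -/
def ultraproductMk (f : ∀ i, M i) : ultraproduct φ M :=
  (f : (φ : Filter I).Product fun i => M i)

end

section

variable {I : Type u} {φ : Ultrafilter I} {M : I → SPoset S}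

theorem exists_ultraproductMk_eq (a : ultraproduct φ M) :
    ∃ f : ∀ i, M i, ultraproductMk φ M f = a :=
  Quotient.exists_rep a

theorem langStructure_ultraproduct :
    langStructure (ultraproduct φ M) =
      (Language.Ultraproduct.structure : (lang S).Structure ((φ : Filter I).Product fun i => M i)) := by
  refine Language.Structure.ext ?_ ?_
  · funext n f v
    obtain ⟨w, rfl⟩ : ∃ w : Fin n → ∀ i, M i, v = fun k => ultraproductMk φ M (w k) := by
      choose w hw using fun k => exists_ultraproductMk_eq (v k)
      exact ⟨w, funext fun k => (hw k).symm⟩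
    refine Eq.trans ?_ (Language.Ultraproduct.funMap_cast (M := fun i => M i) f w).symm
    cases f
    rfl
  · funext n r v
    obtain ⟨w, rfl⟩ : ∃ w : Fin n → ∀ i, M i, v = fun k => ultraproductMk φ M (w k) := by
      choose w hw using fun k => exists_ultraproductMk_eq (v k)
      exact ⟨w, funext fun k => (hw k).symm⟩
    refine propext (Iff.trans ?_
      (Language.relMap_quotient_mk' ((φ : Filter I).productSetoid fun i => M i) r w).symm)
    cases r
    rfl

/-- Łoś's theorem for ultraproducts of left `S`-posets. -/
theorem realize_ultraproduct {β : Type*} (ψ : (lang S).Formula β) (x : β → ∀ i, M i) :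
    (ψ.Realize fun b => ultraproductMk φ M (x b)) ↔
      ∀ᶠ i in (φ : Filter I), ψ.Realize fun b => x b i := by
  rw [langStructure_ultraproduct]
  exact Language.Ultraproduct.realize_formula_cast (u := φ) (M := fun i => M i) ψ x

end

/-- A model of the theory of a class of left `S`-posets is elementarily embedded in an ultraproduct
of members of that class. -/
theorem exists_ultraproduct_of_models {C : SPoset S → Prop} {A : SPoset S}
    (hA : ∀ ψ : (lang S).Sentence, (∀ B : SPoset S, C B → B ⊨ ψ) → A ⊨ ψ) :
    ∃ (I : Type u) (φ : Ultrafilter I) (M : I → SPoset S) (j : A → ultraproduct φ M),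
      (∀ i, C (M i)) ∧ ∀ ψ : (lang S).Formula A, ψ.Realize j ↔ ψ.Realize (id : A → A) := by
  classical
  let D : Type u := {ψ : (lang S).Formula A // ψ.Realize (id : A → A)}
  -- Otherwise the negated existential closure of the conjunction of `Δ` would hold throughout `C`,
  -- hence in `A`, where the identity assignment refutes it.
  have hfin (Δ : Finset D) : ∃ (B : SPoset S) (v : A → B), C B ∧ ∀ ψ ∈ Δ, ψ.1.Realize v := by
    let χ : (lang S).Formula A := Language.Formula.iInf fun ψ : Δ => ψ.1.1
    by_contra! hno
    have h1 : A ⊨ χ.exClosure.not := by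
      refine hA _ fun B hB => ?_
      rw [Language.Sentence.realize_not,
        ← Language.Formula.exists_realize_equivSentence_iff_realize_exClosure]
      rintro ⟨v, hv⟩
      obtain ⟨ψ, hψ, hn⟩ := hno B v hB
      have := (Language.Formula.realize_equivSentence_symm B (Language.Formula.equivSentence χ) v).2 hv
      rw [Equiv.symm_apply_apply, Language.Formula.realize_iInf] at this
      exact hn (this ⟨ψ, hψ⟩)
    rw [Language.Sentence.realize_not,
        ← Language.Formula.exists_realize_equivSentence_iff_realize_exClosure] at h1
    refine h1 ⟨id, (Language.Formula.realize_equivSentence_symm A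
      (Language.Formula.equivSentence χ) id).1 ?_⟩
    rw [Equiv.symm_apply_apply, Language.Formula.realize_iInf]
    exact fun ψ => ψ.1.2
  choose M v hM hv using hfin
  let φ : Ultrafilter (Finset D) := Ultrafilter.of Filter.atTop
  have key (ψ : (lang S).Formula A) (hψ : ψ.Realize (id : A → A)) :
      ψ.Realize fun a => ultraproductMk φ M fun Δ => v Δ a := by
    rw [realize_ultraproduct]
    refine Ultrafilter.of_le Filter.atTop
      ((Filter.eventually_ge_atTop {⟨ψ, hψ⟩}).mono fun Δ hΔ => ?_)
    exact hv Δ ⟨ψ, hψ⟩ (hΔ (Finset.mem_singleton_self _))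
  refine ⟨Finset D, φ, M, fun a => ultraproductMk φ M fun Δ => v Δ a, hM, fun ψ => ⟨fun h => ?_,
    key ψ⟩⟩
  by_contra hn
  exact key ψ.not hn h

end Ultraproduct
end SPoset

/-! ### Closure criteria for axiomatisability -/

namespace SPoset

section Axiomatisability

variable {S : Type u} [Monoid S] [PartialOrder S]

theorem axiomatisable_of_closed {C : SPoset S → Prop}
    (hC : ∀ (I : Type u) (φ : Ultrafilter I) (M : I → SPoset S), (∀ i, C (M i)) →
      C (ultraproduct φ M))
    (hC' : ∀ (A B : SPoset S) (j : A → B),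
      (∀ ψ : (lang S).Formula A, ψ.Realize j ↔ ψ.Realize (id : A → A)) → C B → C A) :
    Axiomatisable C := by
  refine ⟨{ψ | ∀ B : SPoset S, C B → B ⊨ ψ}, fun A => ⟨fun hA => ⟨fun ψ hψ => hψ A hA⟩, fun hA => ?_⟩⟩
  obtain ⟨I, φ, M, j, hM, hj⟩ := exists_ultraproduct_of_models fun ψ hψ => hA.realize_of_mem ψ hψ
  exact hC' A _ j hj (hC I φ M hM)

/-- Axiomatisable classes are closed under ultraproducts. -/
theorem Axiomatisable.ultraproduct_mem {C : SPoset S → Prop} (hC : Axiomatisable C) {I : Type u}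
    {φ : Ultrafilter I} {M : I → SPoset S} (hM : ∀ i, C (M i)) : C (ultraproduct φ M) := by
  obtain ⟨T, hT⟩ := hC
  refine (hT _).2 ⟨fun ψ hψ => ?_⟩
  have h := (realize_ultraproduct (φ := φ) (M := M) ψ Empty.elim).2
    (.of_forall fun i => ?_)
  · rw [Language.Sentence.Realize]
    convert h
  · have := ((hT _).1 (hM i)).realize_of_mem ψ hψ
    rw [Language.Sentence.Realize] at this
    convert this

/-- The term `s • t`. -/
def smulTerm {β : Type u} (s : S) (t : (lang S).Term β) : (lang S).Term β :=
  Language.Functions.apply₁ (L := lang S) (LangFunctions.act s) t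

theorem realize_smulTerm {A : SPoset S} {β : Type u} (s : S) (t : (lang S).Term β) (v : β → A) :
    (smulTerm s t).realize v = s • t.realize v :=
  rfl

section Elementary

variable {A B : SPoset S} {j : A → B}
  (hj : ∀ ψ : (lang S).Formula A, ψ.Realize j ↔ ψ.Realize (id : A → A))

include hj

theorem injective_of_elementary : Function.Injective j := fun a b h =>
  Language.Formula.realize_equal.1 <|
    (hj ((Language.Term.var a).equal (Language.Term.var b))).1 (Language.Formula.realize_equal.2 h)

theorem le_iff_of_elementary {a b : A} : j a ≤ j b ↔ a ≤ b := by
  exact hj (Language.Relations.formula₂ (L := lang S) LangRelations.le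
    (Language.Term.var a) (Language.Term.var b))

theorem map_smul_of_elementary (s : S) (a : A) : j (s • a) = s • j a := by
  have := hj ((smulTerm s (Language.Term.var a)).equal (Language.Term.var (s • a)))
  rw [Language.Formula.realize_equal, Language.Formula.realize_equal, realize_smulTerm,
    realize_smulTerm] at this
  exact (this.2 rfl).symm

/-- When the solutions coming from `A` are finitely many, "some solution differs from all of them"
is a first order formula with parameters in `A`. A solution outside the range would make it true in
`B`, hence in `A`, which is absurd. -/
theorem mem_range_of_elementary {s : S} {a : A} {b : B} (hb : s • b = j a)
    (hfin : {b : B | s • b = j a}.Finite) : b ∈ Set.range j := by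
  by_contra hbj
  have hF : {c : A | s • j c = j a}.Finite :=
    hfin.preimage (injective_of_elementary hj).injOn
  have : Finite {c : A | s • j c = j a} := hF
  let ψ : (lang S).Formula (A ⊕ PUnit.{u + 1}) :=
    (smulTerm s (Language.Term.var (Sum.inr PUnit.unit))).equal (Language.Term.var (Sum.inl a)) ⊓
    Language.Formula.iInf fun c : {c : A | s • j c = j a} =>
      ((Language.Term.var (Sum.inr PUnit.unit)).equal (Language.Term.var (Sum.inl c.1))).not
  have hψ (D : SPoset S) (k : A → D) : (ψ.iExs PUnit.{u + 1}).Realize k ↔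
      ∃ d : D, s • d = k a ∧ ∀ c : {c : A | s • j c = j a}, d ≠ k c := by
    rw [Language.Formula.realize_iExs]
    simp only [ψ, Language.Formula.realize_inf, Language.Formula.realize_iInf,
      Language.Formula.realize_not, Language.Formula.realize_equal,
      realize_smulTerm, Language.Term.realize_var, Sum.elim_inl, Sum.elim_inr]
    exact ⟨fun ⟨d, hd⟩ => ⟨d PUnit.unit, hd⟩, fun ⟨d, hd⟩ => ⟨fun _ => d, hd⟩⟩
  obtain ⟨d, hd, hd'⟩ := (hψ A id).1 <| (hj _).1 <| (hψ B j).2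
    ⟨b, hb, fun c hc => hbj ⟨c, hc.symm⟩⟩
  exact hd' ⟨d, by
    change s • j d = j a
    rw [← map_smul_of_elementary hj]
    exact congrArg j hd⟩ rfl

end Elementary

/-- Coordinates restrict to elementary substructures when equations `s • b = a` have finitely many
solutions. -/
theorem Coordinates.exists_restrict {A B : SPoset S} {j : A → B}
    (hj : ∀ ψ : (lang S).Formula A, ψ.Realize j ↔ ψ.Realize (id : A → A))
    (hS : ∀ x y : S, {w : S | x * w = y}.Finite) (c : B.Coordinates) :
    ∃ d : A.Coordinates, ∀ a, d.coeff (d.gen a) = c.coeff (c.gen (j a)) := by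
  choose g hg using fun a => mem_range_of_elementary hj (c.coeff_smul_gen (j a))
    (c.finite_setOf_smul_eq hS _ _)
  have hinj := injective_of_elementary hj
  have hsmul := map_smul_of_elementary hj
  refine ⟨⟨g, fun a => c.coeff (j a), fun s a => hinj ?_, fun {a b} hab => hinj ?_, fun s a => ?_,
    fun {a b} hab => ?_, fun a => hinj ?_⟩, fun a => congrArg c.coeff (hg a)⟩
  · rw [hg, hg, hsmul, c.gen_smul]
  · rw [hg, hg, c.gen_eq_of_le ((le_iff_of_elementary hj).2 hab)]
  · rw [hsmul, c.coeff_smul]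
  · exact c.coeff_mono ((le_iff_of_elementary hj).2 hab)
  · rw [hsmul, hg, c.coeff_smul_gen]

variable [MulLeftMono S] [MulRightMono S]

variable (S) in
/-- The left `S`-poset `S`. -/
def regular : SPoset S where
  carrier := S
  ordered :=
    { smul_le_smul_left := fun _ _ h c => mul_le_mul_right h c
      smul_le_smul_right := fun _ _ h a => mul_le_mul_left h a }
  nonempty := ⟨(1 : S)⟩

theorem regular_isFree : IsFree (regular S) :=
  isFree_iff.2 ⟨⟨fun _ => (1 : S), fun a => a, fun _ _ => rfl, fun _ => rfl, fun _ _ => rfl,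
    fun h => h, fun a => mul_one (M := S) a⟩, fun _ => rfl⟩

theorem IsFree.isProjective {A : SPoset S} (hA : IsFree A) : IsProjective A :=
  isProjective_iff.2 ⟨(isFree_iff.1 hA).choose⟩

theorem ultrapower_eq_ultraproduct {I : Type u} (φ : Ultrafilter I) :
    ultrapower S φ = ultraproduct φ fun _ => regular S :=
  rfl

/-- Coordinates on the factors and on the ultrapower of `S` give coordinates on an ultraproduct. -/
theorem Coordinates.exists_ultraproduct {I : Type u} {φ : Ultrafilter I} {M : I → SPoset S}
    (c : (ultrapower S φ).Coordinates) (d : ∀ i, (M i).Coordinates) :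
    ∃ e : (ultraproduct φ M).Coordinates, c.Unital → (∀ i, (d i).Unital) → e.Unital := by
  let co : ultraproduct φ M → ultrapower S φ :=
    Quotient.map (fun f i => (d i).coeff (f i)) fun f g h => by
      filter_upwards [h] with i hi
      rw [hi]
  let ge : ultraproduct φ M → ultraproduct φ M :=
    Quotient.map (fun f i => (d i).gen (f i)) fun f g h => by
      filter_upwards [h] with i hi
      rw [hi]
  let mu : ultrapower S φ → ultraproduct φ M → ultraproduct φ M :=
    Quotient.map₂ (fun f g i => f i • g i) fun f f' h g g' h' => by
      filter_upwards [h, h'] with i hi hi'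
      rw [hi, hi']
  have mu_smul (s : S) (a b) : mu (s • a) b = s • mu a b :=
    Quotient.inductionOn₂ a b fun f g => congrArg _ (funext fun i => mul_smul s (f i) (g i))
  have mu_co_ge (a) : mu (co a) (ge a) = a :=
    Quotient.inductionOn a fun f => congrArg _ (funext fun i => (d i).coeff_smul_gen (f i))
  have co_smul (s : S) (a) : co (s • a) = s • co a :=
    Quotient.inductionOn a fun f => congrArg _ (funext fun i => (d i).coeff_smul s (f i))
  have ge_smul (s : S) (a) : ge (s • a) = ge a :=
    Quotient.inductionOn a fun f => congrArg (Quotient.mk _) (funext fun i => (d i).gen_smul s (f i))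
  have co_mono {a b} : a ≤ b → co a ≤ co b :=
    Quotient.inductionOn₂ a b fun f g h =>
      Filter.Eventually.mono h fun i hi => (d i).coeff_mono hi
  have ge_mono {a b} : a ≤ b → ge a = ge b :=
    Quotient.inductionOn₂ a b fun f g h =>
      Quotient.sound (Filter.Eventually.mono h fun i hi => (d i).gen_eq_of_le hi)
  have co_mu (hd : ∀ i, (d i).Unital) (a b) : co (mu a (ge b)) = a :=
    Quotient.inductionOn₂ a b fun f g => congrArg (Quotient.mk _) (funext fun i => by
      change (d i).coeff (f i • (d i).gen (g i)) = f i
      rw [(d i).coeff_smul, hd i, mul_one])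
  -- Here `a = mu (co a) (ge a)`, and `co a` splits further as `c.coeff (co a) • c.gen (co a)`; the
  -- second factor is absorbed into the generator.
  refine ⟨⟨fun a => mu (c.gen (co a)) (ge a), fun a => c.coeff (co a), fun s a => ?_,
    fun {a b} h => ?_, fun s a => ?_, fun h => c.coeff_mono (co_mono h), fun a => ?_⟩,
    fun hc hd a => ?_⟩
  · rw [co_smul, c.gen_smul, ge_smul]
  · rw [c.gen_eq_of_le (co_mono h), ge_mono h]
  · rw [co_smul, c.coeff_smul]
  · rw [← mu_smul, c.coeff_smul_gen, mu_co_ge]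
  · change c.coeff (co (mu (c.gen (co a)) (ge a))) = 1
    rw [co_mu hd, hc]

end Axiomatisability

end SPoset

/-! ### The equivalences -/

theorem theorem6p2 (S : Type u) [Monoid S] [PartialOrder S] [MulLeftMono S] [MulRightMono S] :
    List.TFAE [
      ∀ (I : Type u) (φ : Ultrafilter I), SPoset.IsFree (SPoset.ultrapower S φ),
      SPoset.Axiomatisable (SPoset.IsProjective (S := S)) ∧ ConditionStar S,
      SPoset.Axiomatisable (SPoset.IsFree (S := S))] := by
  tfae_have 1 → 2 := by
    intro h
    have hu := fun I φ => SPoset.isFree_iff.1 (h I φ)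
    refine ⟨SPoset.axiomatisable_of_closed (fun I φ M hM => ?_) fun A B j hj hB => ?_,
      SPoset.conditionStar_of_unital hu⟩
    · obtain ⟨c, -⟩ := hu I φ
      exact SPoset.isProjective_iff.2
        ⟨(c.exists_ultraproduct fun i => (SPoset.isProjective_iff.1 (hM i)).some).choose⟩
    · obtain ⟨c⟩ := SPoset.isProjective_iff.1 hB
      exact SPoset.isProjective_iff.2 ⟨(c.exists_restrict hj (SPoset.finite_setOf_mul_eq hu)).choose⟩
  tfae_have 1 → 3 := by
    intro h
    have hu := fun I φ => SPoset.isFree_iff.1 (h I φ)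
    refine SPoset.axiomatisable_of_closed (fun I φ M hM => ?_) fun A B j hj hB => ?_
    · obtain ⟨c, hc⟩ := hu I φ
      choose d hd using fun i => SPoset.isFree_iff.1 (hM i)
      obtain ⟨e, he⟩ := c.exists_ultraproduct d
      exact (he hc hd).isFree
    · obtain ⟨c, hc⟩ := SPoset.isFree_iff.1 hB
      obtain ⟨d, hd⟩ := c.exists_restrict hj (SPoset.finite_setOf_mul_eq hu)
      exact SPoset.isFree_iff.2 ⟨d, fun a => (hd a).trans (hc _)⟩
  tfae_have 2 → 1 := by
    rintro ⟨h, hS⟩ I φ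
    have hp : SPoset.IsProjective (SPoset.ultrapower S φ) := by
        rw [SPoset.ultrapower_eq_ultraproduct]
        exact h.ultraproduct_mem fun _ => SPoset.regular_isFree.isProjective
    obtain ⟨c⟩ := SPoset.isProjective_iff.1 hp
    exact (SPoset.unital_of_conditionStar hS c).isFree
  tfae_have 3 → 1 := by
    intro h I φ
    rw [SPoset.ultrapower_eq_ultraproduct]
    exact h.ultraproduct_mem fun _ => SPoset.regular_isFree
  tfae_finish
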